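/- Let $p$ be a prime, let $n\ge 0$ be an integer, and let $P_n$ be a Sylow $p$-subgroup of the symmetric group $S_{p^n}$. Write $C_{p-1}^n$ for the direct product of $n$ copies of the cyclic group of order $p-1$, and $Z(P_n)$ for the centre of $P_n$. Then: 1. The centralizer and the normalizer of $P_n$ in $S_{p^n}$ satisfy $C_{S_{p^n}}(P_n) = Z(P_n)$ and $N_{S_{p^n}}(P_n)/P_n \cong C_{p-1}^n$. 2. The automorphism group $\operatorname{Aut}(P_n)$ has a normal Sylow $p$-subgroup $Q$, and $\operatorname{Aut}(P_n)/Q \cong C_{p-1}^n$. In particular, if $p=2$, then $\operatorname{Aut}(P_n)$ is a $2$-group and $P_n$ is self-normalizing in $S_{2^n}$, that is, $N_{S_{2^n}}(P_n) = P_n$. -/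

import Mathlib

/-! A Sylow `p`-subgroup `P` of `S_{p^n}` is an iterated wreath product of groups of order `p`.
Everything follows from a homomorphism `d : Aut(P) → (F_p^×)^n` whose kernel is a `p`-group and
which is surjective already on automorphisms induced by `N(P)`. Then `ker d` is the normal Sylow
subgroup of `Aut(P)`. As `P` is transitive, its centralizer is a `p`-group, hence so is the kernel
of `d` on `N(P)`; this kernel contains `P`, the target having order prime to `p`, so it equals `P`.

`d` is built by induction on `n`. For odd `p` the base of the wreath product is characteristic, so
an automorphism acts on the top group and scales coordinate sums on the base by a unit, the new
coordinate of `d`. An automorphism of prime order `r ≠ p` in the kernel fixes some full cycle, by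
counting; a full cycle generates its own centralizer, so Thompson's `A × B` lemma makes the
automorphism trivial. For `p = 2` the base need not be characteristic, but the number of full cycles
is a power of `2`, and the same argument shows that `Aut(P)` is a `2`-group. -/

/-! ### Coprime automorphisms of `p`-groups. -/

theorem isPGroup_of_forall_prime_pow_eq_one {G : Type*} [Group G] [Finite G] (p : ℕ)
    (h : ∀ (g : G) (r : ℕ), r.Prime → r ≠ p → g ^ r = 1 → g = 1) : IsPGroup p G := by
  have hn : Nat.card G ≠ 0 := Nat.card_pos.ne'
  refine IsPGroup.of_card (Nat.eq_prime_pow_of_unique_prime_dvd hn ?_)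
  intro r hr hd
  by_contra hne
  have : Fact r.Prime := ⟨hr⟩
  obtain ⟨g, hg⟩ := exists_prime_orderOf_dvd_card' r hd
  have h1 := h g r hr hne (hg ▸ pow_orderOf_eq_one g)
  rw [h1, orderOf_one] at hg
  exact hr.one_lt.ne hg

theorem IsPGroup.eq_one_of_pow_prime_eq_one {G : Type*} [Group G] {p : ℕ} [hp : Fact p.Prime]
    (hG : IsPGroup p G) {r : ℕ} (hr : r.Prime) (hrp : r ≠ p) {g : G} (hg : g ^ r = 1) :
    g = 1 := by
  have hc := hG.orderOf_coprime ((Nat.coprime_primes hp.out hr).2 (Ne.symm hrp)) g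
  exact orderOf_eq_one_iff.1 (Nat.eq_one_of_dvd_coprimes hc dvd_rfl (orderOf_dvd_of_pow_eq_one hg))

theorem MulAut.pow_apply_eq_mul_pow {G : Type*} [Group G] {α : MulAut G} {x z : G}
    (hx : α x = x * z) (hz : α z = z) (k : ℕ) : (α ^ k) x = x * z ^ k := by
  induction k with
  | zero => simp
  | succ k ih => rw [pow_succ', MulAut.mul_apply, ih, map_mul, map_pow, hx, hz, pow_succ', mul_assoc]

/-- A special case of Thompson's `A × B` lemma. -/
theorem MulAut.eq_one_of_forall_commute {G : Type*} [Group G] [Finite G] {p : ℕ}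
    [Fact p.Prime] (hG : IsPGroup p G) {r : ℕ} (hr : r.Prime) (hrp : r ≠ p) {α : MulAut G}
    (hα : α ^ r = 1) (c : G) (hc : ∀ x, Commute x c → α x = x) : α = 1 := by
  have : Group.IsNilpotent G := hG.isNilpotent
  have hN : NormalizerCondition G := Group.normalizerCondition_of_isNilpotent
  rw [normalizerCondition_iff_only_full_group_self_normalizing] at hN
  let C : Subgroup G := α.toMonoidHom.eqLocus (MonoidHom.id G)
  have hmem : ∀ x, x ∈ C ↔ α x = x := fun x => Iff.rfl
  have hcC : c ∈ C := hc c (Commute.refl c)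
  have htop : C = ⊤ := by
    refine hN C (le_antisymm ?_ Subgroup.le_normalizer)
    intro x hx
    -- `α` fixes both `y` and `x * y * x⁻¹`; comparing the two gives the commutation.
    have hcomm : ∀ y ∈ C, Commute (x⁻¹ * α x) y := by
      intro y hy
      have h1 : x * y * x⁻¹ ∈ C := (hx y).1 hy
      rw [hmem, map_mul, map_mul, map_inv, (hmem y).1 hy] at h1
      have h2 : α x * y = x * y * x⁻¹ * α x := by rw [← h1]; group
      change x⁻¹ * α x * y = y * (x⁻¹ * α x)
      rw [mul_assoc, h2]; group
    have hz := hc _ (hcomm c hcC)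
    -- With `z = x⁻¹ * α x` fixed by `α`, the relation `α ^ r = 1` forces `z ^ r = 1`.
    have hpow := MulAut.pow_apply_eq_mul_pow (α := α) (x := x) (by group) hz r
    rw [hα, MulAut.one_apply, left_eq_mul] at hpow
    have h1 := hG.eq_one_of_pow_prime_eq_one hr hrp hpow
    rw [hmem]
    exact (inv_mul_eq_one.1 h1).symm
  ext x
  exact (hmem x).1 (htop ▸ Subgroup.mem_top x)

theorem MulAut.exists_fixed_of_not_dvd {G : Type*} [Group G] [Finite G] {r : ℕ} (hr : r.Prime)
    {α : MulAut G} (hα : α ^ r = 1) (E : Set G) (hE : ∀ x ∈ E, α x ∈ E)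
    (hcard : ¬ r ∣ Nat.card E) : ∃ x ∈ E, α x = x := by
  classical
  have : Fact r.Prime := ⟨hr⟩
  have : Fintype E := Fintype.ofFinite E
  rw [Nat.card_eq_fintype_card] at hcard
  have hmap : Set.MapsTo α E E := hE
  let σ : Equiv.Perm E := Equiv.ofBijective (hmap.restrict α E E)
    (Finite.injective_iff_bijective.1 (hmap.restrict_inj.2 α.injective.injOn))
  have hpow : ∀ (k : ℕ) (x : E), (((σ ^ k) x : E) : G) = (α ^ k) x := by
    intro k
    induction k with
    | zero => intro x; simp
    | succ k ih =>
      intro x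
      rw [pow_succ', pow_succ', Equiv.Perm.mul_apply, MulAut.mul_apply, ← ih]
      rfl
  have hσ : σ ^ r ^ 1 = 1 := by
    ext x
    rw [pow_one, hpow, hα]
    rfl
  obtain ⟨a, ha⟩ := Equiv.Perm.exists_fixed_point_of_prime hcard hσ
  exact ⟨a, a.2, congrArg Subtype.val ha⟩

theorem MulAut.exists_fixed_mem_coset {G : Type*} [Group G] [Finite G] {p : ℕ}
    [hp : Fact p.Prime] (hG : IsPGroup p G) {r : ℕ} (hr : r.Prime) (hrp : r ≠ p) {α : MulAut G}
    (hα : α ^ r = 1) (K : Subgroup G) (y : G)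
    (hK : ∀ x, y⁻¹ * x ∈ K → y⁻¹ * α x ∈ K) : ∃ x, y⁻¹ * x ∈ K ∧ α x = x := by
  refine MulAut.exists_fixed_of_not_dvd hr hα {x | y⁻¹ * x ∈ K} hK ?_
  obtain ⟨k, hk⟩ := IsPGroup.iff_card.1 (hG.to_subgroup K)
  have e : {x | y⁻¹ * x ∈ K} ≃ K :=
    { toFun := fun x => ⟨y⁻¹ * x, x.2⟩
      invFun := fun z => ⟨y * z, by simp⟩
      left_inv := fun x => by simp
      right_inv := fun z => by simp }
  rw [Nat.card_congr e, hk]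
  intro h
  exact hrp ((Nat.prime_dvd_prime_iff_eq hr hp.out).1 (hr.dvd_of_dvd_pow h))

/-! ### Centralizers, normalizers and automorphisms of a Sylow subgroup. -/

/-- An element of prime order `r ≠ p` fixes a point because `r ∤ p ^ n`; commuting with a transitive
group, it then fixes every point. -/
theorem isPGroup_centralizer_of_isPretransitive {p n : ℕ} [hp : Fact p.Prime] {Ω : Type*} [Finite Ω]
    (hΩ : Nat.card Ω = p ^ n) (H : Subgroup (Equiv.Perm Ω))
    (hH : ∀ a b : Ω, ∃ h ∈ H, h a = b) :
    IsPGroup p (Subgroup.centralizer (H : Set (Equiv.Perm Ω))) := by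
  classical
  have : Fintype Ω := Fintype.ofFinite Ω
  refine isPGroup_of_forall_prime_pow_eq_one p ?_
  rintro ⟨g, hg⟩ r hr hrp hgr
  have : Fact r.Prime := ⟨hr⟩
  have hgr' : g ^ r ^ 1 = 1 := by
    rw [pow_one]; exact congrArg Subtype.val hgr
  have hcard : ¬ r ∣ Fintype.card Ω := by
    rw [← Nat.card_eq_fintype_card, hΩ]
    intro h
    exact hrp ((Nat.prime_dvd_prime_iff_eq hr hp.out).1 (hr.dvd_of_dvd_pow h))
  obtain ⟨a, ha⟩ := Equiv.Perm.exists_fixed_point_of_prime hcard hgr'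
  apply Subtype.ext
  apply Equiv.ext
  intro b
  obtain ⟨h, hh, rfl⟩ := hH a b
  have h1 := congrArg (fun σ : Equiv.Perm Ω => σ a) (Subgroup.mem_centralizer_iff.1 hg h hh)
  simp only [Equiv.Perm.mul_apply, ha] at h1
  exact h1.symm

theorem ZMod.not_dvd_card_units_pi (p n : ℕ) [hp : Fact p.Prime] :
    ¬ p ∣ Nat.card (Fin n → (ZMod p)ˣ) := by
  rw [Nat.card_eq_fintype_card, Fintype.card_fun, ZMod.card_units, Fintype.card_fin]
  intro h
  have h1 := hp.out.dvd_of_dvd_pow h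
  have h2 := hp.out.one_lt
  have := Nat.le_of_dvd (by omega) h1
  omega

theorem nonempty_units_zmod_mulEquiv (p n : ℕ) [hp : Fact p.Prime] :
    Nonempty ((Fin n → (ZMod p)ˣ) ≃* (Fin n → Multiplicative (ZMod (p - 1)))) := by
  have h1 : Nat.card (ZMod p)ˣ = p - 1 := by
    rw [Nat.card_eq_fintype_card, ZMod.card_units]
  have h2 : Nat.card (Multiplicative (ZMod (p - 1))) = p - 1 := Nat.card_zmod (p - 1)
  have e : (ZMod p)ˣ ≃* Multiplicative (ZMod (p - 1)) := mulEquivOfCyclicCardEq (h1.trans h2.symm)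
  exact ⟨MulEquiv.piCongrRight fun _ => e⟩

section Sylow

variable {S : Type*} [Group S] {p n : ℕ}

theorem Sylow.centralizer_eq_map_center [Finite S] (P : Sylow p S)
    (hC : IsPGroup p (Subgroup.centralizer ((P : Subgroup S) : Set S))) :
    Subgroup.centralizer ((P : Subgroup S) : Set S) =
      (Subgroup.center (P : Subgroup S)).map (P : Subgroup S).subtype := by
  have hle : Subgroup.centralizer ((P : Subgroup S) : Set S) ≤ (P : Subgroup S) := by
    have h1 := hC.to_sup_of_normal_right' P.2 (Subgroup.centralizer_le_normalizer _)
    have h2 := P.3 h1 le_sup_right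
    exact le_sup_left.trans h2.le
  ext x
  constructor
  · intro hx
    refine ⟨⟨x, hle hx⟩, ?_, rfl⟩
    rw [SetLike.mem_coe, Subgroup.mem_center_iff]
    intro g
    exact Subtype.ext (Subgroup.mem_centralizer_iff.1 hx g g.2)
  · rintro ⟨y, hy, rfl⟩
    rw [SetLike.mem_coe, Subgroup.mem_center_iff] at hy
    rw [Subgroup.mem_centralizer_iff]
    intro g hg
    exact congrArg Subtype.val (hy ⟨g, hg⟩)

theorem Sylow.ker_comp_normalizerMonoidHom [hp : Fact p.Prime] (P : Sylow p S)
    (hC : IsPGroup p (Subgroup.centralizer ((P : Subgroup S) : Set S)))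
    (d : MulAut (P : Subgroup S) →* (Fin n → (ZMod p)ˣ)) (hd : IsPGroup p d.ker) :
    (d.comp (P : Subgroup S).normalizerMonoidHom).ker =
      (P : Subgroup S).subgroupOf (Subgroup.normalizer ((P : Subgroup S) : Set S)) := by
  set N := Subgroup.normalizer ((P : Subgroup S) : Set S)
  set K := (d.comp (P : Subgroup S).normalizerMonoidHom).ker
  have hK : IsPGroup p K := by
    have h1 : K = d.ker.comap (P : Subgroup S).normalizerMonoidHom := (MonoidHom.comap_ker _ _).symm
    rw [h1]
    refine hd.comap_of_ker_isPGroup _ ?_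
    rw [Subgroup.normalizerMonoidHom_ker]
    exact hC.comap_subtype
  have hPK : (P : Subgroup S).subgroupOf N ≤ K := by
    intro x hx
    rw [MonoidHom.mem_ker]
    have hPN : IsPGroup p ((P : Subgroup S).subgroupOf N) := P.2.comap_subtype
    obtain ⟨k, hk⟩ := hPN ⟨x, hx⟩
    have hk' : x ^ p ^ k = 1 := congrArg Subtype.val hk
    have h2 : orderOf (d.comp (P : Subgroup S).normalizerMonoidHom x) ∣ p ^ k :=
      orderOf_dvd_of_pow_eq_one (by rw [← map_pow, hk', map_one])
    have h3 := orderOf_dvd_natCard (d.comp (P : Subgroup S).normalizerMonoidHom x)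
    have h4 : Nat.Coprime (p ^ k) (Nat.card (Fin n → (ZMod p)ˣ)) :=
      Nat.Coprime.pow_left _ ((Nat.Prime.coprime_iff_not_dvd hp.out).2
        (ZMod.not_dvd_card_units_pi p n))
    exact orderOf_eq_one_iff.1 (Nat.eq_one_of_dvd_coprimes h4 h2 h3)
  -- `K` lives in `N`; maximality of `P` applies to its image in `S`.
  have hmap : (P : Subgroup S) ≤ K.map N.subtype := by
    intro x hx
    exact ⟨⟨x, Subgroup.le_normalizer hx⟩, hPK hx, rfl⟩
  have heq := P.3 (hK.map N.subtype) hmap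
  refine le_antisymm ?_ hPK
  intro x hx
  rw [Subgroup.mem_subgroupOf]
  have h := Subgroup.mem_map_of_mem N.subtype hx
  rwa [heq] at h

theorem Sylow.exists_normal_mulAut [Fact p.Prime] (P : Sylow p S)
    (d : MulAut (P : Subgroup S) →* (Fin n → (ZMod p)ˣ)) (hd : IsPGroup p d.ker)
    (hs : Function.Surjective d) :
    ∃ (Q : Sylow p (MulAut (P : Subgroup S))) (_ : (Q : Subgroup (MulAut (P : Subgroup S))).Normal),
      Nonempty ((MulAut (P : Subgroup S) ⧸ (Q : Subgroup (MulAut (P : Subgroup S)))) ≃*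
        (Fin n → (ZMod p)ˣ)) := by
  have hidx : ¬ p ∣ d.ker.index := by
    rw [Subgroup.index_ker, MonoidHom.range_eq_top.2 hs, Subgroup.card_top]
    exact ZMod.not_dvd_card_units_pi p n
  refine ⟨hd.toSylow hidx, ?_, ?_⟩
  · rw [IsPGroup.toSylow_coe]; infer_instance
  · exact ⟨QuotientGroup.quotientKerEquivOfSurjective d hs⟩

end Sylow

/-! ### Full cycles on `p ^ n` points. -/

section FullCycle

variable {G Ω : Type*} [Group G] [MulAction G Ω] [FaithfulSMul G Ω] {p : ℕ} [hp : Fact p.Prime]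

/-- The order is the lcm of the cycle lengths, and among powers of `p` the lcm is one of them. -/
theorem exists_period_eq_of_orderOf_eq_prime_pow [Nonempty Ω] {m : ℕ} {g : G}
    (hg : orderOf g = p ^ m) : ∃ w : Ω, MulAction.period g w = p ^ m := by
  by_contra! h
  have hdvd : ∀ w : Ω, MulAction.period g w ∣ p ^ m := fun w =>
    hg ▸ MulAction.period_dvd_orderOf g w
  cases m with
  | zero =>
    obtain ⟨w⟩ := ‹Nonempty Ω›
    exact h w (by simpa using hdvd w)
  | succ m =>
    have h1 : g ^ p ^ m = 1 := by
      apply FaithfulSMul.eq_of_smul_eq_smul (α := Ω)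
      intro w
      rw [one_smul, MulAction.pow_smul_eq_iff_period_dvd]
      obtain ⟨k, hk, hk'⟩ := (Nat.dvd_prime_pow hp.out).1 (hdvd w)
      rw [hk']
      refine pow_dvd_pow p ?_
      rcases Nat.lt_or_ge k (m + 1) with h2 | h2
      · omega
      · exact absurd (by rw [hk', le_antisymm hk h2]) (h w)
    have h2 := orderOf_dvd_of_pow_eq_one h1
    rw [hg, Nat.pow_dvd_pow_iff_le_right hp.out.one_lt] at h2
    omega

omit [FaithfulSMul G Ω] in
theorem injective_pow_smul_of_period_eq {m : ℕ} {g : G} {w : Ω} (h : MulAction.period g w = m) :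
    Function.Injective (fun i : Fin m => g ^ (i : ℕ) • w) := by
  have key : ∀ i j : Fin m, i ≤ j → g ^ (i : ℕ) • w = g ^ (j : ℕ) • w → i = j := by
    intro i j hij heq
    have h1 : g ^ ((j : ℕ) - i) • w = w := by
      have h2 : g ^ (j : ℕ) = g ^ (i : ℕ) * g ^ ((j : ℕ) - i) := by
        rw [← pow_add, Nat.add_sub_cancel' hij]
      rw [h2, mul_smul] at heq
      exact ((smul_left_cancel_iff _).1 heq).symm
    rw [MulAction.pow_smul_eq_iff_period_dvd, h] at h1
    have h3 := Nat.eq_zero_of_dvd_of_lt h1 (by omega)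
    ext
    have : (i : ℕ) ≤ j := hij
    omega
  intro i j heq
  rcases le_total i j with hij | hij
  · exact key i j hij heq
  · exact (key j i hij heq.symm).symm

theorem le_of_orderOf_eq_prime_pow [Finite Ω] {m n : ℕ} (hΩ : Nat.card Ω = p ^ n) {g : G}
    (hg : orderOf g = p ^ m) : m ≤ n := by
  have : Nonempty Ω := (Nat.card_pos_iff.1 (hΩ ▸ pow_pos hp.out.pos n)).1
  obtain ⟨w, hw⟩ := exists_period_eq_of_orderOf_eq_prime_pow (Ω := Ω) hg
  have h := Nat.card_le_card_of_injective _ (injective_pow_smul_of_period_eq hw)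
  rw [Nat.card_fin, hΩ] at h
  exact (Nat.pow_le_pow_iff_right hp.out.one_lt).1 h

theorem bijective_pow_smul_of_orderOf_eq_card [Finite Ω] {n : ℕ} (hΩ : Nat.card Ω = p ^ n) {g : G}
    (hg : orderOf g = p ^ n) (w : Ω) :
    Function.Bijective (fun i : Fin (p ^ n) => g ^ (i : ℕ) • w) := by
  have : Nonempty Ω := ⟨w⟩
  obtain ⟨w₀, hw₀⟩ := exists_period_eq_of_orderOf_eq_prime_pow (Ω := Ω) hg
  have hcard : Nat.card (Fin (p ^ n)) = Nat.card Ω := by rw [Nat.card_fin, hΩ]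
  have hinj := injective_pow_smul_of_period_eq hw₀
  have hbij := hinj.bijective_of_nat_card_le hcard.ge
  obtain ⟨j, rfl⟩ := hbij.2 w
  have : (fun i : Fin (p ^ n) => g ^ (i : ℕ) • g ^ (j : ℕ) • w₀) =
      (fun v => g ^ (j : ℕ) • v) ∘ (fun i : Fin (p ^ n) => g ^ (i : ℕ) • w₀) := by
    ext i
    simp only [Function.comp_apply, ← mul_smul, ← pow_add, Nat.add_comm]
  change Function.Bijective (fun i : Fin (p ^ n) => g ^ (i : ℕ) • g ^ (j : ℕ) • w₀)
  rw [this]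
  exact (MulAction.bijective _).comp hbij

/-- Since the powers of `g` are transitive, `x` is determined by the image of one point, where it
agrees with some `g ^ k`. -/
theorem exists_eq_pow_of_commute_of_orderOf_eq_card [Finite Ω] {n : ℕ} (hΩ : Nat.card Ω = p ^ n)
    {g x : G} (hg : orderOf g = p ^ n) (hx : Commute x g) : ∃ k : ℕ, x = g ^ k := by
  have : Nonempty Ω := (Nat.card_pos_iff.1 (hΩ ▸ pow_pos hp.out.pos n)).1
  obtain ⟨w⟩ := this
  have hb := bijective_pow_smul_of_orderOf_eq_card hΩ hg w
  obtain ⟨k, hk⟩ := hb.2 (x • w)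
  refine ⟨k, FaithfulSMul.eq_of_smul_eq_smul (α := Ω) fun v => ?_⟩
  obtain ⟨i, rfl⟩ := hb.2 v
  simp only at hk ⊢
  rw [← mul_smul, (hx.pow_right i).eq, mul_smul, ← hk, ← mul_smul, ← mul_smul, ← pow_add, ← pow_add,
    Nat.add_comm]

theorem MulAut.eq_one_of_fixes_full_cycle [Finite G] [Finite Ω] {n : ℕ}
    (hΩ : Nat.card Ω = p ^ n) (hG : IsPGroup p G) {r : ℕ} (hr : r.Prime) (hrp : r ≠ p)
    {α : MulAut G} (hα : α ^ r = 1) {c : G} (hc : orderOf c = p ^ n) (hαc : α c = c) : α = 1 := by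
  refine MulAut.eq_one_of_forall_commute hG hr hrp hα c fun x hx => ?_
  obtain ⟨k, rfl⟩ := exists_eq_pow_of_commute_of_orderOf_eq_card hΩ hc hx
  rw [map_pow, hαc]

end FullCycle

/-! ### The wreath product and its full cycles. -/

/-- The permutational wreath product of the integers modulo `p` by a group `G` acting on `Ω`. -/
@[ext]
structure PermWreath (p : ℕ) (Ω G : Type*) where
  base : Ω → ZMod p
  top : G

namespace PermWreath

variable {p : ℕ} {G Ω : Type*} [Group G] [MulAction G Ω]

/-- In `x * y` the factor `y` acts first, which makes `(w, a) ↦ (x.top • w, a + x.base w)` a left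
action. -/
instance : Mul (PermWreath p Ω G) :=
  ⟨fun x y => ⟨fun w => y.base w + x.base (y.top • w), x.top * y.top⟩⟩

instance : One (PermWreath p Ω G) := ⟨⟨fun _ => 0, 1⟩⟩

instance : Inv (PermWreath p Ω G) := ⟨fun x => ⟨fun w => - x.base (x.top⁻¹ • w), x.top⁻¹⟩⟩

@[simp] theorem mul_base (x y : PermWreath p Ω G) (w : Ω) :
    (x * y).base w = y.base w + x.base (y.top • w) := rfl
@[simp] theorem mul_top (x y : PermWreath p Ω G) : (x * y).top = x.top * y.top := rfl
omit [MulAction G Ω] in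
@[simp] theorem one_base (w : Ω) : (1 : PermWreath p Ω G).base w = 0 := rfl
omit [MulAction G Ω] in
@[simp] theorem one_top : (1 : PermWreath p Ω G).top = 1 := rfl
@[simp] theorem inv_base (x : PermWreath p Ω G) (w : Ω) :
    x⁻¹.base w = - x.base (x.top⁻¹ • w) := rfl
@[simp] theorem inv_top (x : PermWreath p Ω G) : x⁻¹.top = x.top⁻¹ := rfl

instance : Group (PermWreath p Ω G) :=
  Group.ofLeftAxioms
    (fun x y z => by ext <;> simp [mul_smul, mul_assoc, add_assoc])
    (fun x => by ext <;> simp)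
    (fun x => by ext <;> simp)

instance : MulAction (PermWreath p Ω G) (Ω × ZMod p) where
  smul x v := (x.top • v.1, v.2 + x.base v.1)
  one_smul v := by
    change ((1 : G) • v.1, v.2 + 0) = v
    simp
  mul_smul x y v := by
    change ((x.top * y.top) • v.1, v.2 + (y.base v.1 + x.base (y.top • v.1))) =
      (x.top • y.top • v.1, v.2 + y.base v.1 + x.base (y.top • v.1))
    rw [mul_smul, add_assoc]

theorem smul_def (x : PermWreath p Ω G) (v : Ω × ZMod p) :
    x • v = (x.top • v.1, v.2 + x.base v.1) := rfl

instance [FaithfulSMul G Ω] : FaithfulSMul (PermWreath p Ω G) (Ω × ZMod p) where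
  eq_of_smul_eq_smul {x y} h := by
    ext w
    · have := congrArg Prod.snd (h (w, 0))
      simpa [smul_def] using this
    · apply FaithfulSMul.eq_of_smul_eq_smul (α := Ω)
      intro w
      exact congrArg Prod.fst (h (w, 0))

/-- The underlying product decomposition. -/
def equivProd (p : ℕ) (Ω G : Type*) : PermWreath p Ω G ≃ G × (Ω → ZMod p) where
  toFun x := (x.top, x.base)
  invFun y := ⟨y.2, y.1⟩
  left_inv _ := rfl
  right_inv _ := rfl

instance [NeZero p] [Finite Ω] [Finite G] : Finite (PermWreath p Ω G) :=
  Finite.of_equiv _ (equivProd p Ω G).symm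

theorem top_pow (x : PermWreath p Ω G) (k : ℕ) : (x ^ k).top = x.top ^ k := by
  induction k with
  | zero => simp
  | succ k ih => rw [pow_succ, mul_top, ih, pow_succ]

theorem base_pow (x : PermWreath p Ω G) (k : ℕ) (w : Ω) :
    (x ^ k).base w = ∑ i ∈ Finset.range k, x.base (x.top ^ i • w) := by
  induction k with
  | zero => simp
  | succ k ih => rw [pow_succ', mul_base, ih, Finset.sum_range_succ, top_pow]

variable [Fintype Ω]

/-- The sum of all coordinates in the base. -/
def coordSum (x : PermWreath p Ω G) : ZMod p := ∑ w, x.base w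

theorem coordSum_mul (x y : PermWreath p Ω G) :
    (x * y).coordSum = x.coordSum + y.coordSum := by
  simp only [coordSum, mul_base, Finset.sum_add_distrib]
  rw [add_comm]
  congr 1
  exact Equiv.sum_comp (MulAction.toPerm y.top) x.base

omit [MulAction G Ω] in
theorem coordSum_one : (1 : PermWreath p Ω G).coordSum = 0 := by simp [coordSum]

theorem coordSum_inv (x : PermWreath p Ω G) : x⁻¹.coordSum = - x.coordSum := by
  have h := coordSum_mul x⁻¹ x
  rw [inv_mul_cancel, coordSum_one] at h
  exact eq_neg_of_add_eq_zero_left h.symm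

variable [FaithfulSMul G Ω] [hp : Fact p.Prime] {n : ℕ}

/-- The powers `x.top ^ i` with `i < p ^ n` carry `w` through every point once, so every coordinate
is collected, whatever the start. -/
theorem pow_card_eq (hΩ : Nat.card Ω = p ^ n) {x : PermWreath p Ω G}
    (hx : orderOf x.top = p ^ n) : x ^ p ^ n = ⟨fun _ => x.coordSum, 1⟩ := by
  ext w
  · rw [base_pow, Finset.sum_range]
    exact Function.Bijective.sum_comp (bijective_pow_smul_of_orderOf_eq_card hΩ hx w) x.base
  · rw [top_pow, ← hx, pow_orderOf_eq_one]

omit [Fintype Ω] [FaithfulSMul G Ω] hp in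
theorem pow_prime_eq_one {x : PermWreath p Ω G} (hx : x.top = 1) : x ^ p = 1 := by
  ext w
  · rw [base_pow]
    simp [hx]
  · rw [top_pow, hx, one_pow, one_top]

/-- Base elements have exponent `p`, so maximal order forces a full cycle on top, and then the `p ^
n`-th power is the constant `x.coordSum`. -/
theorem orderOf_eq_iff (hG : IsPGroup p G) (hΩ : Nat.card Ω = p ^ n) (x : PermWreath p Ω G) :
    orderOf x = p ^ (n + 1) ↔ orderOf x.top = p ^ n ∧ x.coordSum ≠ 0 := by
  have : Nonempty Ω := (Nat.card_pos_iff.1 (hΩ ▸ pow_pos hp.out.pos n)).1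
  obtain ⟨w⟩ := this
  constructor
  · intro hx
    obtain ⟨k, hk⟩ := IsPGroup.iff_orderOf.1 hG x.top
    have hkn := le_of_orderOf_eq_prime_pow hΩ hk
    have h1 : x ^ p ^ (k + 1) = 1 := by
      rw [pow_succ, pow_mul]
      exact pow_prime_eq_one (by rw [top_pow, ← hk, pow_orderOf_eq_one])
    have h2 := orderOf_dvd_of_pow_eq_one h1
    rw [hx, Nat.pow_dvd_pow_iff_le_right hp.out.one_lt] at h2
    obtain rfl : k = n := by omega
    refine ⟨hk, fun h0 => ?_⟩
    have h3 : x ^ p ^ k = 1 := by rw [pow_card_eq hΩ hk, h0]; rfl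
    have h4 := orderOf_dvd_of_pow_eq_one h3
    rw [hx, Nat.pow_dvd_pow_iff_le_right hp.out.one_lt] at h4
    omega
  · rintro ⟨hx, h0⟩
    have h1 := pow_card_eq hΩ hx
    refine orderOf_eq_prime_pow ?_ ?_
    · intro h
      rw [h1] at h
      exact h0 (congrFun (congrArg base h) w)
    · rw [pow_succ, pow_mul]
      exact pow_prime_eq_one (by rw [h1])

end PermWreath

/-! ### Automorphisms of the wreath product. -/

namespace PermWreath

variable {p : ℕ} {G Ω : Type*} [Group G] [MulAction G Ω]

theorem apply_top_congr
    (hA : ∀ (α : MulAut (PermWreath p Ω G)) x, x.top = 1 → (α x).top = 1)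
    (α : MulAut (PermWreath p Ω G)) {x y : PermWreath p Ω G} (h : x.top = y.top) :
    (α x).top = (α y).top := by
  have h1 := hA α (x⁻¹ * y) (by simp [h])
  rw [map_mul, map_inv, mul_top, inv_top] at h1
  exact inv_mul_eq_one.1 h1

/-- The action on the top group of automorphisms stabilizing the base group. -/
def descend (hA : ∀ (α : MulAut (PermWreath p Ω G)) x, x.top = 1 → (α x).top = 1) :
    MulAut (PermWreath p Ω G) →* MulAut G where
  toFun α :=
    { toFun := fun g => (α ⟨fun _ => 0, g⟩).top
      invFun := fun g => (α⁻¹ ⟨fun _ => 0, g⟩).top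
      left_inv := fun g => by
        change (α⁻¹ ⟨fun _ => 0, (α ⟨fun _ => 0, g⟩).top⟩).top = g
        refine (apply_top_congr hA α⁻¹ (x := ⟨fun _ => 0, (α ⟨fun _ => 0, g⟩).top⟩) (y := α ⟨fun _ => 0, g⟩) rfl).trans ?_
        rw [MulAut.inv_apply_self]
      right_inv := fun g => by
        change (α ⟨fun _ => 0, (α⁻¹ ⟨fun _ => 0, g⟩).top⟩).top = g
        refine (apply_top_congr hA α (x := ⟨fun _ => 0, (α⁻¹ ⟨fun _ => 0, g⟩).top⟩) (y := α⁻¹ ⟨fun _ => 0, g⟩) rfl).trans ?_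
        rw [MulAut.apply_inv_self]
      map_mul' := fun g h => by
        rw [← mul_top, ← map_mul]
        exact apply_top_congr hA α rfl }
  map_one' := by ext g; rfl
  map_mul' α β := by
    ext g
    exact apply_top_congr hA α (x := β ⟨fun _ => 0, g⟩) rfl

theorem apply_top (hA : ∀ (α : MulAut (PermWreath p Ω G)) x, x.top = 1 → (α x).top = 1)
    (α : MulAut (PermWreath p Ω G)) (x : PermWreath p Ω G) :
    (α x).top = descend hA α x.top :=
  apply_top_congr hA α rfl

variable [Fintype Ω]

section Scale

variable [DecidableEq Ω]

omit [Group G] [MulAction G Ω] in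
theorem coordSum_single (w : Ω) (a : ZMod p) (g : G) :
    (⟨Pi.single w a, g⟩ : PermWreath p Ω G).coordSum = a := by
  simp [coordSum]

/-- Conjugation by `g` moves the coordinate from `w` to `g • w`, and `coordSum`, a homomorphism to
an abelian group, ignores conjugation. -/
theorem coordSum_apply_single_eq [MulAction.IsPretransitive G Ω]
    (α : MulAut (PermWreath p Ω G)) (w v : Ω) (a : ZMod p) :
    (α ⟨Pi.single w a, 1⟩).coordSum = (α ⟨Pi.single v a, 1⟩).coordSum := by
  obtain ⟨g, rfl⟩ := MulAction.exists_smul_eq G w v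
  have h : (⟨Pi.single (g • w) a, 1⟩ : PermWreath p Ω G) =
      ⟨fun _ => 0, g⟩ * ⟨Pi.single w a, 1⟩ * ⟨fun _ => 0, g⟩⁻¹ := by
    ext u
    · simp [Pi.single_apply, inv_smul_eq_iff]
    · simp
  rw [h, map_mul, map_mul, coordSum_mul, coordSum_mul, map_inv, coordSum_inv]
  ring

/-- On the base, `coordSum ∘ α` is a linear form with equal values on all unit vectors, hence a
multiple of the sum. -/
theorem coordSum_apply_of_top_eq_one [MulAction.IsPretransitive G Ω]
    (α : MulAut (PermWreath p Ω G)) (w : Ω) {x : PermWreath p Ω G} (hx : x.top = 1) :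
    (α x).coordSum = (α ⟨Pi.single w 1, 1⟩).coordSum * x.coordSum := by
  let F : (Ω → ZMod p) →+ ZMod p :=
    { toFun := fun f => (α ⟨f, 1⟩).coordSum
      map_zero' := by
        have : (⟨0, 1⟩ : PermWreath p Ω G) = 1 := rfl
        rw [this, map_one, coordSum_one]
      map_add' := fun f g => by
        have : (⟨f + g, 1⟩ : PermWreath p Ω G) = ⟨g, 1⟩ * ⟨f, 1⟩ := by ext <;> simp
        rw [this, map_mul, coordSum_mul, add_comm] }
  have hF : ∀ f, F f = F (Pi.single w 1) * ∑ v, f v := by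
    intro f
    have h1 : f = ∑ v, f v • Pi.single v (1 : ZMod p) := by
      ext u; simp [Finset.sum_apply, Pi.single_apply]
    conv_lhs => rw [h1]
    rw [map_sum, Finset.mul_sum]
    refine Finset.sum_congr rfl fun v _ => ?_
    rw [ZMod.map_smul, smul_eq_mul, mul_comm]
    congr 1
    exact coordSum_apply_single_eq α v w 1
  have hx' : x = ⟨x.base, 1⟩ := by ext <;> simp [hx]
  have h2 : (α x).coordSum = F x.base := by rw [hx']; rfl
  rw [h2, hF]
  rfl

/-- The scalar by which an automorphism acts on the coordinate sum of base elements. -/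
def scale [MulAction.IsPretransitive G Ω]
    (hA : ∀ (α : MulAut (PermWreath p Ω G)) x, x.top = 1 → (α x).top = 1) (w : Ω) :
    MulAut (PermWreath p Ω G) →* (ZMod p)ˣ :=
  MonoidHom.toHomUnits
    { toFun := fun α => (α ⟨Pi.single w 1, 1⟩).coordSum
      map_one' := by rw [MulAut.one_apply, coordSum_single]
      map_mul' := fun α β => by
        rw [MulAut.mul_apply, coordSum_apply_of_top_eq_one α w (hA β _ rfl)] }

theorem coordSum_apply [MulAction.IsPretransitive G Ω]
    (hA : ∀ (α : MulAut (PermWreath p Ω G)) x, x.top = 1 → (α x).top = 1) (w : Ω)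
    (α : MulAut (PermWreath p Ω G)) {x : PermWreath p Ω G} (hx : x.top = 1) :
    (α x).coordSum = scale hA w α * x.coordSum :=
  coordSum_apply_of_top_eq_one α w hx

end Scale

variable [FaithfulSMul G Ω] [hp : Fact p.Prime] {n : ℕ}

omit [Fintype Ω] in
-- This intrinsic description makes the base characteristic. If `x.top` moves `w`, conjugate by the
-- unit vector at `w` and compare coordinates at `w`: the result is `2 = 0` or `1 = 0`, according to
-- whether `x.top ^ 2` fixes `w`.
theorem top_eq_one_iff (hp2 : p ≠ 2) (x : PermWreath p Ω G) :
    x.top = 1 ↔ ∀ y, Commute (y * x * y⁻¹) x := by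
  classical
  constructor
  · intro hx y
    ext w
    · simp [hx, add_comm]
    · simp [hx]
  · intro h
    apply FaithfulSMul.eq_of_smul_eq_smul (α := Ω)
    intro w
    rw [one_smul]
    by_contra hw
    have h1 := h ⟨Pi.single w 1, 1⟩
    have h2 := congrFun (congrArg base h1.eq) w
    simp only [mul_base, inv_base, inv_top, mul_top, inv_one, one_smul, one_mul, mul_one] at h2
    simp only [Pi.single_apply, hw, if_true, if_false] at h2
    have h4 : (2 : ZMod p) ≠ 0 := by
      intro h5
      have h6 : ((2 : ℕ) : ZMod p) = 0 := by exact_mod_cast h5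
      rw [ZMod.natCast_eq_zero_iff, Nat.prime_dvd_prime_iff_eq hp.out Nat.prime_two] at h6
      exact hp2 h6
    split_ifs at h2
    · exact h4 (by linear_combination h2)
    · exact one_ne_zero (α := ZMod p) (by linear_combination h2)

omit [Fintype Ω] in
theorem apply_top_eq_one (hp2 : p ≠ 2) (α : MulAut (PermWreath p Ω G)) (x : PermWreath p Ω G)
    (hx : x.top = 1) : (α x).top = 1 := by
  rw [top_eq_one_iff hp2] at hx ⊢
  intro y
  have h := (hx (α⁻¹ y)).map α
  simpa using h

/-- An automorphism in `K` of prime order `r ≠ p` is trivial on the top and preserves coordinate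
sums on the base. A fixed point above `c` extends this preservation to all elements above `c`; so
those with sum `1` form a stable coset of `B`, and a fixed point there is a full cycle. -/
theorem isPGroup_of_descend_of_scale [DecidableEq Ω] [Finite G] [MulAction.IsPretransitive G Ω]
    (hA : ∀ (α : MulAut (PermWreath p Ω G)) x, x.top = 1 → (α x).top = 1) (w : Ω)
    (hG : IsPGroup p G) (hW : IsPGroup p (PermWreath p Ω G)) (hΩ : Nat.card Ω = p ^ n)
    {c : G} (hc : orderOf c = p ^ n) {D : Subgroup (MulAut G)} (hD : IsPGroup p D)
    (K : Subgroup (MulAut (PermWreath p Ω G))) (hK : ∀ α ∈ K, descend hA α ∈ D)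
    (hK' : ∀ α ∈ K, scale hA w α = 1) : IsPGroup p K := by
  refine isPGroup_of_forall_prime_pow_eq_one p ?_
  rintro ⟨α, hα⟩ r hr hrp h
  have hαr : α ^ r = 1 := congrArg Subtype.val h
  apply Subtype.ext
  change α = 1
  have hdesc : descend hA α = 1 := by
    have h1 : (⟨descend hA α, hK α hα⟩ : D) ^ r = 1 := by
      apply Subtype.ext
      change descend hA α ^ r = 1
      rw [← map_pow, hαr, map_one]
    exact congrArg Subtype.val (hD.eq_one_of_pow_prime_eq_one hr hrp h1)
  have htop : ∀ x, (α x).top = x.top := fun x => by rw [apply_top hA, hdesc]; rfl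
  have hsum : ∀ x, x.top = 1 → (α x).coordSum = x.coordSum := fun x hx => by
    rw [coordSum_apply hA w α hx, hK' α hα]; simp
  let A : Subgroup (PermWreath p Ω G) :=
    { carrier := {x | x.top = 1}
      mul_mem' := fun {a b} ha hb => by simp_all
      one_mem' := rfl
      inv_mem' := fun {a} ha => by simp_all }
  let B : Subgroup (PermWreath p Ω G) :=
    { carrier := {x | x.top = 1 ∧ x.coordSum = 0}
      mul_mem' := fun {a b} ha hb => by simp_all [coordSum_mul]
      one_mem' := ⟨rfl, coordSum_one⟩
      inv_mem' := fun {a} ha => by simp_all [coordSum_inv] }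
  obtain ⟨x₀, hx₀, hfix₀⟩ := MulAut.exists_fixed_mem_coset hW hr hrp hαr A ⟨fun _ => 0, c⟩ (by
    intro x hx
    change (_ : PermWreath p Ω G).top = 1 at hx
    change (_ : PermWreath p Ω G).top = 1
    rw [mul_top, htop]
    exact hx)
  have hx₀c : x₀.top = c := (inv_mul_eq_one.1 hx₀).symm
  have hsum' : ∀ x, x.top = c → (α x).coordSum = x.coordSum := by
    intro x hx
    have h1 : x = x₀ * (x₀⁻¹ * x) := by group
    have h2 : (x₀⁻¹ * x).top = 1 := by simp [hx, hx₀c]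
    rw [h1, map_mul, coordSum_mul, hfix₀, hsum _ h2, ← coordSum_mul]
  obtain ⟨x₁, hx₁, hfix₁⟩ := MulAut.exists_fixed_mem_coset hW hr hrp hαr B ⟨Pi.single w 1, c⟩ (by
    intro x hx
    obtain ⟨ha, hb⟩ := hx
    have hxc : x.top = c := (inv_mul_eq_one.1 ha).symm
    refine ⟨?_, ?_⟩
    · rw [mul_top, htop]; exact ha
    · rw [coordSum_mul, hsum' x hxc, ← coordSum_mul]; exact hb)
  obtain ⟨ha, hb⟩ := hx₁
  have hx₁c : x₁.top = c := (inv_mul_eq_one.1 ha).symm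
  have hx₁s : x₁.coordSum = 1 := by
    rw [coordSum_mul, coordSum_inv, coordSum_single] at hb
    linear_combination hb
  refine MulAut.eq_one_of_fixes_full_cycle (Ω := Ω × ZMod p) (n := n + 1) ?_ hW hr hrp hαr
    ((orderOf_eq_iff hG hΩ x₁).2 ⟨hx₁c ▸ hc, by rw [hx₁s]; exact one_ne_zero⟩) hfix₁
  rw [Nat.card_prod, hΩ, Nat.card_zmod, pow_succ]

omit [Fintype Ω] [FaithfulSMul G Ω] hp in
/-- An automorphism of the top group induced by a permutation, together with a scalar, lifts to the
wreath product. -/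
def liftAut (u : (ZMod p)ˣ) (s : Equiv.Perm Ω) (α : MulAut G)
    (h : ∀ g w, α g • s w = s (g • w)) : MulAut (PermWreath p Ω G) where
  toFun x := ⟨fun w => u * x.base (s.symm w), α x.top⟩
  invFun x := ⟨fun w => ↑u⁻¹ * x.base (s w), α.symm x.top⟩
  left_inv x := by
    ext w
    · change (↑u⁻¹ : ZMod p) * (↑u * x.base (s.symm (s w))) = x.base w
      rw [s.symm_apply_apply, Units.inv_mul_cancel_left]
    · exact α.symm_apply_apply _
  right_inv x := by
    ext w
    · change (↑u : ZMod p) * (↑u⁻¹ * x.base (s (s.symm w))) = x.base w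
      rw [s.apply_symm_apply, Units.mul_inv_cancel_left]
    · exact α.apply_symm_apply _
  map_mul' x y := by
    ext w
    · have h1 : s.symm (α y.top • w) = y.top • s.symm w := by
        rw [Equiv.symm_apply_eq, ← h, Equiv.apply_symm_apply]
      simp [h1, mul_add]
    · simp

end PermWreath

/-! ### The induction on `n`. -/

theorem ZMod.two_ne_zero_iff : ∀ a : ZMod 2, a ≠ 0 ↔ a - 1 = 0 := by decide

theorem ZMod.subsingleton_units_two : Subsingleton (ZMod 2)ˣ := ⟨by decide⟩

/-- The inductive description of a Sylow `p`-subgroup `G` of the symmetric group on a set `Ω`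
with `p ^ n` elements, together with the structure of its automorphism group. -/
structure IsSymSylow (p n : ℕ) (G Ω : Type*) [Group G] [MulAction G Ω] : Prop where
  card_point : Nat.card Ω = p ^ n
  card_group : Nat.card G = p ^ (p ^ n).factorial.factorization p
  exists_orderOf : ∃ c : G, orderOf c = p ^ n
  card_orderOf : p = 2 → ∃ k, Nat.card {g : G // orderOf g = p ^ n} = p ^ k
  exists_hom : ∃ d : MulAut G →* (Fin n → (ZMod p)ˣ), IsPGroup p d.ker ∧
    ∀ t, ∃ (s : Equiv.Perm Ω) (α : MulAut G), (∀ g w, α g • s w = s (g • w)) ∧ d α = t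

namespace IsSymSylow

variable {p n : ℕ} {G Ω : Type*} [Group G] [MulAction G Ω]

theorem base_case (p : ℕ) : IsSymSylow p 0 (Equiv.Perm Unit) Unit where
  card_point := by simp
  card_group := by simp
  exists_orderOf := ⟨1, by simp⟩
  card_orderOf _ := ⟨0, by
    have : Unique {g : Equiv.Perm Unit // orderOf g = p ^ 0} :=
      { default := ⟨1, by simp⟩, uniq := fun _ => Subtype.ext (Subsingleton.elim _ _) }
    rw [Nat.card_unique, pow_zero]⟩
  exists_hom := ⟨1, by
    have : Subsingleton (MulAut (Equiv.Perm Unit)) :=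
      ⟨fun α β => by ext⟩
    exact IsPGroup.of_subsingleton p _, fun t => ⟨1, 1, fun _ _ => rfl, Subsingleton.elim _ _⟩⟩

variable [FaithfulSMul G Ω] [hp : Fact p.Prime]

theorem isPretransitive [Finite Ω] (h : IsSymSylow p n G Ω) : MulAction.IsPretransitive G Ω := by
  obtain ⟨c, hc⟩ := h.exists_orderOf
  refine ⟨fun v w => ?_⟩
  obtain ⟨i, hi⟩ := (bijective_pow_smul_of_orderOf_eq_card h.card_point hc v).2 w
  exact ⟨c ^ (i : ℕ), hi⟩

omit [FaithfulSMul G Ω] hp in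
theorem isPGroup (h : IsSymSylow p n G Ω) : IsPGroup p G := IsPGroup.of_card h.card_group

omit [FaithfulSMul G Ω] in
theorem card_permWreath [Finite Ω] (h : IsSymSylow p n G Ω) :
    Nat.card (PermWreath p Ω G) = p ^ (p ^ (n + 1)).factorial.factorization p := by
  rw [Nat.card_congr (PermWreath.equivProd p Ω G), Nat.card_prod, Nat.card_fun, h.card_point,
    h.card_group, Nat.card_zmod, ← pow_add, pow_succ', Nat.factorization_factorial_mul hp.out]

theorem exists_orderOf_permWreath [Fintype Ω] (h : IsSymSylow p n G Ω) :
    ∃ c : PermWreath p Ω G, orderOf c = p ^ (n + 1) := by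
  classical
  obtain ⟨w⟩ : Nonempty Ω := (Nat.card_pos_iff.1 (h.card_point ▸ pow_pos hp.out.pos n)).1
  obtain ⟨c, hc⟩ := h.exists_orderOf
  refine ⟨⟨Pi.single w 1, c⟩, (PermWreath.orderOf_eq_iff h.isPGroup h.card_point _).2 ⟨hc, ?_⟩⟩
  rw [PermWreath.coordSum_single]
  exact one_ne_zero

/-- Over `ZMod 2` a nonzero sum equals `1`, so a full cycle is a full cycle on top together with a
vector in one coset of the kernel of the sum. -/
theorem card_orderOf_permWreath [Fintype Ω] [Finite G] (h : IsSymSylow p n G Ω) (hp2 : p = 2) :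
    ∃ k, Nat.card {x : PermWreath p Ω G // orderOf x = p ^ (n + 1)} = p ^ k := by
  classical
  subst hp2
  obtain ⟨w⟩ : Nonempty Ω := (Nat.card_pos_iff.1 (h.card_point ▸ pow_pos hp.out.pos n)).1
  obtain ⟨k, hk⟩ := h.card_orderOf rfl
  let σ : (Ω → ZMod 2) →+ ZMod 2 :=
    { toFun := fun f => ∑ v, f v
      map_zero' := by simp
      map_add' := fun f g => Finset.sum_add_distrib }
  have hmul : IsPGroup 2 (Multiplicative (Ω → ZMod 2)) :=
    IsPGroup.of_card (n := Nat.card Ω) (by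
      change Nat.card (Ω → ZMod 2) = _
      rw [Nat.card_fun, Nat.card_zmod])
  obtain ⟨m, hm⟩ := IsPGroup.iff_card.1 (hmul.to_subgroup (AddSubgroup.toSubgroup σ.ker))
  have hm' : Nat.card σ.ker = 2 ^ m := hm
  have hw : σ (Pi.single w 1) = 1 := by simp [σ]
  have e : {x : PermWreath 2 Ω G // orderOf x = 2 ^ (n + 1)} ≃
      {g : G // orderOf g = 2 ^ n} × σ.ker :=
    { toFun := fun x => ⟨⟨x.1.top, ((PermWreath.orderOf_eq_iff h.isPGroup h.card_point _).1 x.2).1⟩,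
        ⟨x.1.base - Pi.single w 1, by
          rw [AddMonoidHom.mem_ker, map_sub, hw, ← ZMod.two_ne_zero_iff]
          exact ((PermWreath.orderOf_eq_iff h.isPGroup h.card_point _).1 x.2).2⟩⟩
      invFun := fun y => ⟨⟨y.2.1 + Pi.single w 1, y.1.1⟩,
        (PermWreath.orderOf_eq_iff h.isPGroup h.card_point _).2 ⟨y.1.2, by
          change σ (y.2.1 + Pi.single w 1) ≠ 0
          rw [map_add, hw, AddMonoidHom.mem_ker.1 y.2.2, zero_add]
          exact one_ne_zero⟩⟩
      left_inv := fun x => by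
        apply Subtype.ext
        ext <;> simp
      right_inv := fun y => by
        ext <;> simp }
  exact ⟨k + m, by rw [Nat.card_congr e, Nat.card_prod, hk, hm', pow_add]⟩

theorem isPGroup_mulAut_of_card_orderOf [Finite Ω] [Finite G] (hΩ : Nat.card Ω = p ^ n)
    (hG : IsPGroup p G) (hcard : ∃ k, Nat.card {g : G // orderOf g = p ^ n} = p ^ k) :
    IsPGroup p (MulAut G) := by
  refine isPGroup_of_forall_prime_pow_eq_one p fun α r hr hrp hα => ?_
  obtain ⟨c, hc, hfix⟩ := MulAut.exists_fixed_of_not_dvd hr hα {g | orderOf g = p ^ n}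
    (fun x hx => (MulEquiv.orderOf_eq α x).trans hx) (by
      obtain ⟨k, hk⟩ := hcard
      intro hd
      have hd' : r ∣ p ^ k := hk ▸ hd
      exact hrp ((Nat.prime_dvd_prime_iff_eq hr hp.out).1 (hr.dvd_of_dvd_pow hd')))
  exact MulAut.eq_one_of_fixes_full_cycle hΩ hG hr hrp hα hc hfix

/-- The scale on the base is coordinate `0`; the others come from the top group. The permutation `s`
is carried along so that surjectivity persists on the normalizer. -/
theorem exists_hom_permWreath [Fintype Ω] [Finite G] (h : IsSymSylow p n G Ω) (hp2 : p ≠ 2) :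
    ∃ d : MulAut (PermWreath p Ω G) →* (Fin (n + 1) → (ZMod p)ˣ), IsPGroup p d.ker ∧
      ∀ t, ∃ (s : Equiv.Perm (Ω × ZMod p)) (α : MulAut (PermWreath p Ω G)),
        (∀ g w, α g • s w = s (g • w)) ∧ d α = t := by
  classical
  obtain ⟨w⟩ : Nonempty Ω := (Nat.card_pos_iff.1 (h.card_point ▸ pow_pos hp.out.pos n)).1
  have := h.isPretransitive
  have hA := PermWreath.apply_top_eq_one (p := p) (G := G) (Ω := Ω) hp2
  obtain ⟨d, hd, hsurj⟩ := h.exists_hom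
  obtain ⟨c, hc⟩ := h.exists_orderOf
  let D : MulAut (PermWreath p Ω G) →* (Fin (n + 1) → (ZMod p)ˣ) :=
    MonoidHom.pi (Fin.cases (PermWreath.scale hA w)
      (fun i => (Pi.evalMonoidHom _ i).comp (d.comp (PermWreath.descend hA))))
  have hD0 : ∀ α, D α 0 = PermWreath.scale hA w α := fun α => rfl
  have hDs : ∀ α i, D α (Fin.succ i) = d (PermWreath.descend hA α) i := fun α i => rfl
  refine ⟨D, ?_, ?_⟩
  · refine PermWreath.isPGroup_of_descend_of_scale hA w h.isPGroup (IsPGroup.of_card h.card_permWreath)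
      h.card_point hc hd _ ?_ ?_
    · intro α hα
      rw [MonoidHom.mem_ker] at hα ⊢
      ext1 i
      rw [← hDs, hα]
      rfl
    · intro α hα
      rw [MonoidHom.mem_ker] at hα
      rw [← hD0, hα]
      rfl
  · intro t
    obtain ⟨s, α, hs, hα⟩ := hsurj (Fin.tail t)
    -- The map `(v, a) ↦ (s v, t 0 * a)` on points induces `α` on the top and the scalar `t 0` on
    -- the base.
    refine ⟨s.prodCongr (Units.mulLeft (t 0)), PermWreath.liftAut (t 0) s α hs, ?_, ?_⟩
    · rintro g ⟨v, a⟩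
      refine Prod.ext (hs g.top v) ?_
      change (t 0 : ZMod p) * a + t 0 * g.base (s.symm (s v)) = t 0 * (a + g.base v)
      rw [s.symm_apply_apply, mul_add]
    · ext1 i
      refine Fin.cases ?_ (fun i => ?_) i
      · rw [hD0]
        ext
        change (PermWreath.liftAut (t 0) s α hs ⟨Pi.single w 1, 1⟩).coordSum = _
        change ∑ v, (t 0 : ZMod p) * (Pi.single w 1 : Ω → ZMod p) (s.symm v) = _
        rw [← Finset.mul_sum, Equiv.sum_comp s.symm (Pi.single w 1 : Ω → ZMod p)]
        simp
      · rw [hDs]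
        have : PermWreath.descend hA (PermWreath.liftAut (t 0) s α hs) = α := by
          ext g; rfl
        rw [this, hα]
        rfl

theorem permWreath [Fintype Ω] [Finite G] (h : IsSymSylow p n G Ω) :
    IsSymSylow p (n + 1) (PermWreath p Ω G) (Ω × ZMod p) where
  card_point := by rw [Nat.card_prod, h.card_point, Nat.card_zmod, pow_succ]
  card_group := h.card_permWreath
  exists_orderOf := h.exists_orderOf_permWreath
  card_orderOf := h.card_orderOf_permWreath
  exists_hom := by
    by_cases hp2 : p = 2
    · have hcard := h.card_orderOf_permWreath hp2
      have hpt : Nat.card (Ω × ZMod p) = p ^ (n + 1) := by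
        rw [Nat.card_prod, h.card_point, Nat.card_zmod, pow_succ]
      have hP := isPGroup_mulAut_of_card_orderOf hpt (IsPGroup.of_card h.card_permWreath) hcard
      subst hp2
      have := ZMod.subsingleton_units_two
      -- For `p = 2` the target is trivial, so the trivial homomorphism serves.
      exact ⟨1, hP.to_subgroup _, fun t => ⟨1, 1, fun _ _ => rfl, Subsingleton.elim _ _⟩⟩
    · exact h.exists_hom_permWreath hp2

theorem exists_model (p : ℕ) [Fact p.Prime] (n : ℕ) :
    ∃ (G Ω : Type) (_ : Group G) (_ : Finite G) (_ : Fintype Ω) (_ : MulAction G Ω)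
      (_ : FaithfulSMul G Ω), IsSymSylow p n G Ω := by
  induction n with
  | zero =>
    exact ⟨Equiv.Perm Unit, Unit, _, inferInstance, inferInstance, _, inferInstance, base_case p⟩
  | succ n ih =>
    obtain ⟨G, Ω, _, _, _, _, _, h⟩ := ih
    exact ⟨PermWreath p Ω G, Ω × ZMod p, _, inferInstance, inferInstance, _, inferInstance,
      h.permWreath⟩

end IsSymSylow

/-! ### Transfer to an arbitrary Sylow subgroup. -/

/-- A Sylow subgroup of the symmetric group on `p ^ n` points is isomorphic, as a permutation group,
to any group acting faithfully as such a Sylow subgroup. -/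
theorem IsSymSylow.exists_mulEquiv {p n : ℕ} [hp : Fact p.Prime] {G Ω : Type*} [Group G] [Finite G]
    [Fintype Ω] [MulAction G Ω] [FaithfulSMul G Ω] (h : IsSymSylow p n G Ω)
    (P : Sylow p (Equiv.Perm (Fin (p ^ n)))) :
    ∃ (e : Ω ≃ Fin (p ^ n)) (β : G ≃* (P : Subgroup (Equiv.Perm (Fin (p ^ n))))),
      ∀ g w, (β g : Equiv.Perm (Fin (p ^ n))) (e w) = e (g • w) := by
  have e₀ : Ω ≃ Fin (p ^ n) := Finite.equivFinOfCardEq h.card_point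
  let ι : G →* Equiv.Perm (Fin (p ^ n)) :=
    e₀.permCongrHom.toMonoidHom.comp (MulAction.toPermHom G Ω)
  have hι : Function.Injective ι :=
    e₀.permCongrHom.injective.comp MulAction.toPerm_injective
  have hcard : Nat.card ι.range = p ^ (Nat.card (Equiv.Perm (Fin (p ^ n)))).factorization p := by
    rw [← Nat.card_congr (MonoidHom.ofInjective hι).toEquiv, h.card_group, Nat.card_perm,
      Nat.card_fin]
  -- The image of `G` is Sylow by its order; Sylow conjugacy then moves it onto the given subgroup.
  let P₀ : Sylow p (Equiv.Perm (Fin (p ^ n))) := Sylow.ofCard ι.range hcard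
  obtain ⟨σ, rfl⟩ := MulAction.exists_smul_eq (Equiv.Perm (Fin (p ^ n))) P₀ P
  let γ : G →* Equiv.Perm (Fin (p ^ n)) := (MulAut.conj σ).toMonoidHom.comp ι
  have hγ : Function.Injective γ := (MulAut.conj σ).injective.comp hι
  have hrange : γ.range = ((σ • P₀ : Sylow p (Equiv.Perm (Fin (p ^ n)))) :
      Subgroup (Equiv.Perm (Fin (p ^ n)))) := by
    rw [MonoidHom.range_comp]
    rfl
  refine ⟨e₀.trans σ, (MonoidHom.ofInjective hγ).trans (MulEquiv.subgroupCongr hrange), ?_⟩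
  intro g w
  change σ (e₀ (g • e₀.symm (σ.symm (σ (e₀ w))))) = σ (e₀ (g • w))
  simp

theorem Sylow.exists_hom_mulAut {p n : ℕ} [hp : Fact p.Prime]
    (P : Sylow p (Equiv.Perm (Fin (p ^ n)))) :
    IsPGroup p (Subgroup.centralizer ((P : Subgroup (Equiv.Perm (Fin (p ^ n)))) :
      Set (Equiv.Perm (Fin (p ^ n))))) ∧
    ∃ d : MulAut (P : Subgroup (Equiv.Perm (Fin (p ^ n)))) →* (Fin n → (ZMod p)ˣ),
      IsPGroup p d.ker ∧ Function.Surjective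
        (d.comp (P : Subgroup (Equiv.Perm (Fin (p ^ n)))).normalizerMonoidHom) := by
  obtain ⟨G, Ω, _, _, _, _, _, h⟩ := IsSymSylow.exists_model p n
  obtain ⟨e, β, hβ⟩ := h.exists_mulEquiv P
  obtain ⟨d, hd, hs⟩ := h.exists_hom
  have := h.isPretransitive
  refine ⟨isPGroup_centralizer_of_isPretransitive (Nat.card_fin _) _ fun a b => ?_,
    d.comp (MulAut.congr β).symm.toMonoidHom, ?_, ?_⟩
  · obtain ⟨g, hg⟩ := MulAction.exists_smul_eq G (e.symm a) (e.symm b)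
    refine ⟨β g, (β g).2, ?_⟩
    have := hβ g (e.symm a)
    rwa [hg, e.apply_symm_apply, e.apply_symm_apply] at this
  · rw [← MonoidHom.comap_ker]
    exact hd.comap_of_injective _ (MulAut.congr β).symm.injective
  · intro t
    obtain ⟨s, α, hα, rfl⟩ := hs t
    let σ : Equiv.Perm (Fin (p ^ n)) := e.permCongr s
    -- Compatibility of `s` with `α` says that conjugation by `σ` induces `α`; in particular `σ`
    -- normalizes `P`.
    have hσ : ∀ g, σ * β g * σ⁻¹ = β (α g) := by
      intro g
      rw [mul_inv_eq_iff_eq_mul]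
      ext1 x
      obtain ⟨w, rfl⟩ := e.surjective x
      have h1 : ∀ v, σ (e v) = e (s v) := fun v => by simp [σ]
      rw [Equiv.Perm.mul_apply, Equiv.Perm.mul_apply, hβ, h1, h1, hβ, hα]
    have hmem : σ ∈ Subgroup.normalizer ((P : Subgroup (Equiv.Perm (Fin (p ^ n)))) :
        Set (Equiv.Perm (Fin (p ^ n)))) := by
      intro x
      constructor
      · intro hx
        obtain ⟨g, hg⟩ := β.surjective ⟨x, hx⟩
        have hg' : (β g : Equiv.Perm (Fin (p ^ n))) = x := congrArg Subtype.val hg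
        rw [← hg', hσ]
        exact (β (α g)).2
      · intro hx
        obtain ⟨g, hg⟩ := β.surjective ⟨_, hx⟩
        have hg' : (β g : Equiv.Perm (Fin (p ^ n))) = σ * x * σ⁻¹ := congrArg Subtype.val hg
        have h2 := hσ (α.symm g)
        rw [MulEquiv.apply_symm_apply, hg'] at h2
        have h3 := mul_left_cancel (mul_right_cancel h2)
        rw [← h3]
        exact (β _).2
    refine ⟨⟨σ, hmem⟩, ?_⟩
    change d ((MulAut.congr β).symm _) = d α
    congr 1
    rw [MulEquiv.symm_apply_eq]
    ext1 x
    obtain ⟨g, rfl⟩ := β.surjective x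
    apply Subtype.ext
    change σ * β g * σ⁻¹ = β (α (β.symm (β g)))
    rw [hσ, MulEquiv.symm_apply_apply]

theorem proposition1p3 (p : ℕ) [Fact p.Prime] (n : ℕ)
    (P : Sylow p (Equiv.Perm (Fin (p ^ n)))) :
    (Subgroup.centralizer ((P : Subgroup (Equiv.Perm (Fin (p ^ n)))) :
          Set (Equiv.Perm (Fin (p ^ n)))) =
        (Subgroup.center (P : Subgroup (Equiv.Perm (Fin (p ^ n))))).map
          (P : Subgroup (Equiv.Perm (Fin (p ^ n)))).subtype ∧
      Nonempty
        ((Subgroup.normalizer ((P : Subgroup (Equiv.Perm (Fin (p ^ n)))) :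
              Set (Equiv.Perm (Fin (p ^ n)))) ⧸
            (P : Subgroup (Equiv.Perm (Fin (p ^ n)))).subgroupOf
              (Subgroup.normalizer ((P : Subgroup (Equiv.Perm (Fin (p ^ n)))) :
                Set (Equiv.Perm (Fin (p ^ n)))))) ≃*
          (Fin n → Multiplicative (ZMod (p - 1))))) ∧
    (∃ (Q : Sylow p (MulAut (P : Subgroup (Equiv.Perm (Fin (p ^ n))))))
        (_ : (Q : Subgroup (MulAut (P : Subgroup (Equiv.Perm (Fin (p ^ n)))))).Normal),
      Nonempty
        ((MulAut (P : Subgroup (Equiv.Perm (Fin (p ^ n)))) ⧸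
            (Q : Subgroup (MulAut (P : Subgroup (Equiv.Perm (Fin (p ^ n))))))) ≃*
          (Fin n → Multiplicative (ZMod (p - 1))))) ∧
    (p = 2 →
      IsPGroup p (MulAut (P : Subgroup (Equiv.Perm (Fin (p ^ n))))) ∧
      Subgroup.normalizer ((P : Subgroup (Equiv.Perm (Fin (p ^ n)))) :
          Set (Equiv.Perm (Fin (p ^ n)))) =
        (P : Subgroup (Equiv.Perm (Fin (p ^ n))))) := by
  obtain ⟨hC, d, hd, hs⟩ := P.exists_hom_mulAut
  obtain ⟨u⟩ := nonempty_units_zmod_mulEquiv p n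
  have hker := P.ker_comp_normalizerMonoidHom hC d hd
  have hds : Function.Surjective d := by
    rw [MonoidHom.coe_comp] at hs
    exact hs.of_comp
  refine ⟨⟨P.centralizer_eq_map_center hC, ?_⟩, ?_, ?_⟩
  · exact ⟨((QuotientGroup.quotientMulEquivOfEq hker.symm).trans
      (QuotientGroup.quotientKerEquivOfSurjective _ hs)).trans u⟩
  · obtain ⟨Q, hQ, ⟨v⟩⟩ := P.exists_normal_mulAut d hd hds
    exact ⟨Q, hQ, ⟨v.trans u⟩⟩
  · rintro rfl
    -- The target of `d` is trivial, so the kernels of `d` and of its restriction to the normalizer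
    -- are everything.
    have := ZMod.subsingleton_units_two
    have htop : d.ker = ⊤ := by
      rw [eq_top_iff]
      exact fun x _ => Subsingleton.elim _ _
    refine ⟨?_, ?_⟩
    · rw [htop] at hd
      exact hd.of_equiv Subgroup.topEquiv
    · refine le_antisymm ?_ Subgroup.le_normalizer
      rw [← Subgroup.subgroupOf_eq_top, ← hker, eq_top_iff]
      exact fun x _ => Subsingleton.elim _ _
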